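/- **Model.** The input graph $G=(V,E)$ on $n$ nodes is also the communication network. The nodes carry distinct identifiers from $\{0,\dots,N-1\}$, where $N\le n^{c}$ for a constant $c$ of the model; every node initially knows $N$, its own identifier and its degree, and the edges at each node are numbered by ports in an arbitrary way. Computation proceeds in synchronous rounds; in each round every node may send to each neighbour a (possibly different) message of at most $b\lceil\log_2 n\rceil$ bits, $b$ a constant (the $\mathsf{CONGEST}$ model). Local computation is free and deterministic. An algorithm *detects induced copies of $T$* if eventually every node irrevocably outputs yes or no, every node that belongs to an induced copy of $T$ in $G$ outputs yes, and no node outputs yes if $G$ has no induced copy of $T$. A graph is *$d$-degenerate* if every nonempty induced subgraph has a vertex of degree at most $d$. **Theorem.** There is a function $f\colon\mathbb N\times\mathbb N\to\mathbb N$ such that for every constant $c$ there are constants $b,C$ with the following property. For all $d,k\in\mathbb N$ and every tree $T$ on $k$ nodes there is a deterministic algorithm in the $\mathsf{CONGEST}$ model with messages of at most $b\lceil\log_2 n\rceil$ bits (the algorithm may depend on $c$, $d$ and $T$, i.e. all nodes know $c$, $d$ and $T$) that, on every $d$-degenerate graph $G$ on $n$ nodes, for every $N\le n^{c}$, every assignment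 of distinct identifiers from $\{0,\dots,N-1\}$ and every port numbering, detects induced copies of $T$ within $$f(d,k)+C\lceil\log_2 n\rceil = f(d,k)+O(\log n)$$ rounds. -/

import Mathlib

/-- A finite graph is `d`-degenerate if every nonempty induced subgraph `G[S]` has a vertex of
degree at most `d`. -/
def SimpleGraph.IsDegenerate {V : Type*} (G : SimpleGraph V) (d : ℕ) : Prop :=
  ∀ S : Set V, S.Nonempty → ∃ v ∈ S, (G.neighborSet v ∩ S).ncard ≤ d

namespace Congest

/-- A deterministic synchronous message-passing algorithm with Boolean outputs. Local computation
is free, so the local transitions are arbitrary functions.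

* `init N i δ` is the initial state of a node with identifier `i` and degree `δ`; the number `N`
  is known to all nodes.
* `send δ s p` is the bit string that a node of degree `δ` in state `s` sends through its port `p`.
* `recv δ s m` is its next state when it receives the bit string `m p` through each port `p`.
* `out s` is the output fixed so far, if any; an output is never revoked. -/
structure Algorithm where
  State : Type
  init : (N : ℕ) → Fin N → ℕ → State
  send : (δ : ℕ) → State → Fin δ → List Bool
  recv : (δ : ℕ) → State → (Fin δ → List Bool) → State
  out : State → Option Bool
  out_recv : ∀ (δ : ℕ) (s : State) (m : Fin δ → List Bool) (y : Bool),
    out s = some y → out (recv δ s m) = some y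

/-- A network on the communication graph `G`: the nodes carry distinct identifiers from a range of
size `N`, and the edges at each node are numbered by ports, in an arbitrary way. (The bijection
`port v` forces `deg v` to be the degree of `v`.) -/
structure Network {V : Type*} (G : SimpleGraph V) (N : ℕ) where
  ident : V ↪ Fin N
  deg : V → ℕ
  port : (v : V) → Fin (deg v) ≃ G.neighborSet v

namespace Network

variable {V : Type*} {G : SimpleGraph V} {N : ℕ}

/-- The neighbour of `v` behind port `p`. -/
def nbr (net : Network G N) (v : V) (p : Fin (net.deg v)) : V :=
  (net.port v p : V)

/-- The port of that neighbour which leads back to `v`. -/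
def back (net : Network G N) (v : V) (p : Fin (net.deg v)) : Fin (net.deg (net.nbr v p)) :=
  (net.port (net.nbr v p)).symm ⟨v, SimpleGraph.Adj.symm (net.port v p).2⟩

/-- The state of each node after `t` synchronous rounds. -/
def state (net : Network G N) (A : Algorithm) : ℕ → V → A.State
  | 0, v => A.init N (net.ident v) (net.deg v)
  | t + 1, v => A.recv (net.deg v) (state net A t v) fun p =>
      A.send (net.deg (net.nbr v p)) (state net A t (net.nbr v p)) (net.back v p)

/-- The message sent by `v` through port `p` in round `t + 1`. -/
def message (net : Network G N) (A : Algorithm) (t : ℕ) (v : V) (p : Fin (net.deg v)) :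
    List Bool :=
  A.send (net.deg v) (net.state A t v) p

end Network

/-- On the given network, with messages of at most `B` bits, the algorithm `A` terminates
within `R` rounds: by then every node has fixed an output. Moreover the outputs solve
induced `H`-detection: every node that belongs to an induced copy of `H` reports "yes", and no node
reports "yes" if there is no induced copy of `H`. -/
def DetectsInduced {V W : Type*} {G : SimpleGraph V} {N : ℕ} (A : Algorithm) (net : Network G N)
    (H : SimpleGraph W) (B R : ℕ) : Prop :=
  (∀ t < R, ∀ v p, (net.message A t v p).length ≤ B) ∧
  ∃ y : V → Bool, (∀ v, A.out (net.state A R v) = some (y v)) ∧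
    (∀ v, (∃ φ : H ↪g G, v ∈ Set.range φ) → y v = true) ∧
    ((∃ v, y v = true) → Nonempty (H ↪g G))

end Congest

/-! Let `L = Nat.clog 2 N`. Repeatedly removing vertices with at most `4 * d` active neighbours
empties a `d`-degenerate graph within `L + 1` rounds (`peel_eq_empty`), and gives each vertex at
most `4 * d` out-neighbours so that every edge is oriented at least one way (`mem_peelOut_or`).

Colour the vertices partially by nodes of `T` and run arc consistency, also requiring that colours
of out-neighbours be adjacent in `T`. A survivor of `k` rounds yields a colour-preserving
homomorphism from the tree. It is injective because colours differ, and induced because each edge of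
`G` was checked at one of its ends (`nonempty_embedding_of_survives`).

Conversely, a copy survives once it is coloured correctly and its outside out-neighbours are
uncoloured, a condition on at most `k * (4 * d + 1)` vertices. By greedy covering, `O(L)` colourings
of the identifiers realise all such patterns (`exists_hashFamily`). One message carries the bits of
`L + 1` colourings, so a number of chunks independent of `n` suffices. -/

/-- Extends `v₀` along a walk of `T` (read from its end) to a vertex of `G`, choosing at each step
a neighbour that has property `P`. -/
noncomputable def SimpleGraph.Walk.lift {V W : Type*} {T : SimpleGraph W} (G : SimpleGraph V)
    (P : ℕ → W → V → Prop) (n : ℕ) {r : W} (v₀ : V) : {i : W} → T.Walk i r → V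
  | _, .nil => v₀
  | i, .cons _ p =>
    open Classical in
    if h : ∃ w, G.Adj (p.lift G P n v₀) w ∧ P (n - (p.length + 1)) i w then h.choose else v₀

theorem SimpleGraph.Walk.lift_cons {V W : Type*} {T : SimpleGraph W} {G : SimpleGraph V}
    {P : ℕ → W → V → Prop} {n : ℕ} {r : W} {v₀ : V} {i j : W} (hij : T.Adj i j) (p : T.Walk j r)
    (h : ∃ w, G.Adj (p.lift G P n v₀) w ∧ P (n - (p.length + 1)) i w) :
    G.Adj (p.lift G P n v₀) ((Walk.cons hij p).lift G P n v₀) ∧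
      P (n - (p.length + 1)) i ((Walk.cons hij p).lift G P n v₀) := by
  have : (Walk.cons hij p).lift G P n v₀ = h.choose := by
    rw [Walk.lift, dif_pos h]
  rw [this]
  exact h.choose_spec

/-! ### Homomorphisms from trees by local extension -/

section WalkLift

variable {V W : Type*} {T : SimpleGraph W} {G : SimpleGraph V} {P : ℕ → W → V → Prop} {n : ℕ}
  {r : W} {v₀ : V}

theorem SimpleGraph.Walk.lift_spec (h₀ : P n r v₀)
    (hP : ∀ s i v, P (s + 1) i v → ∀ j, T.Adj i j → ∃ w, G.Adj v w ∧ P s j w)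
    {i : W} (p : T.Walk i r) (hp : p.length ≤ n) :
    P (n - p.length) i (p.lift G P n v₀) := by
  induction p with
  | nil => simpa [Walk.lift] using h₀
  | @cons i j r hij p ih =>
    rw [Walk.length_cons] at hp ⊢
    have h := ih h₀ (by omega)
    rw [show n - p.length = n - (p.length + 1) + 1 by omega] at h
    exact (lift_cons hij p (hP _ _ _ h i hij.symm)).2

theorem SimpleGraph.Walk.adj_lift_cons (h₀ : P n r v₀)
    (hP : ∀ s i v, P (s + 1) i v → ∀ j, T.Adj i j → ∃ w, G.Adj v w ∧ P s j w)
    {i j : W} (hij : T.Adj i j) (p : T.Walk j r) (hp : p.length < n) :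
    G.Adj (p.lift G P n v₀) ((Walk.cons hij p).lift G P n v₀) := by
  have h := lift_spec h₀ hP p hp.le
  rw [show n - p.length = n - (p.length + 1) + 1 by omega] at h
  exact (lift_cons hij p (hP _ _ _ h i hij.symm)).1

/-- In a tree, local extendability for more rounds than the tree has vertices yields a
homomorphism. -/
theorem SimpleGraph.IsTree.exists_hom_of_extendable [Fintype W] (hT : T.IsTree)
    (hn : Fintype.card W ≤ n) (h₀ : P n r v₀)
    (hP : ∀ s i v, P (s + 1) i v → ∀ j, T.Adj i j → ∃ w, G.Adj v w ∧ P s j w) :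
    ∃ φ : W → V, (∀ i j, T.Adj i j → G.Adj (φ i) (φ j)) ∧ ∀ i, ∃ s, P (s + 1) i (φ i) := by
  classical
  choose q hq hq' using fun i => hT.existsUnique_path i r
  have hlen : ∀ i, (q i).length < n := fun i => (hq i).length_lt.trans_le hn
  refine ⟨fun i => (q i).lift G P n v₀, fun i j hij => ?_, fun i => ⟨n - (q i).length - 1, ?_⟩⟩
  -- If `i` is off the path from `j` to the root, prepending `i` gives the unique path from `i`.
  · have key : ∀ i j, T.Adj i j → i ∉ (q j).support →
        G.Adj ((q j).lift G P n v₀) ((q i).lift G P n v₀) := fun i j hij hi => by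
      rw [← hq' i _ ((hq j).cons (h := hij) hi)]
      exact Walk.adj_lift_cons h₀ hP hij _ (hlen j)
    by_cases hi : i ∈ (q j).support
    · by_cases hj : j ∈ (q i).support
      · exfalso
        -- Two distinct nodes cannot lie on each other's root paths: each path would be strictly
        -- shorter than the other.
        have shorter : ∀ i j, i ≠ j → i ∈ (q j).support → (q i).length < (q j).length :=
          fun i j hne hi => by
            rw [← hq' i _ ((hq j).dropUntil hi)]
            exact Walk.length_dropUntil_lt_length hi hne
        have h1 := shorter i j hij.ne hi
        have h2 := shorter j i hij.ne' hj
        omega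
      · exact key j i hij.symm hj
    · exact (key i j hij hi).symm
  · have := Walk.lift_spec h₀ hP (q i) (hlen i).le
    rwa [show n - (q i).length - 1 + 1 = n - (q i).length by have := hlen i; omega]

end WalkLift

/-! ### Bounded out-degree orientation by peeling -/

section Degenerate

variable {V : Type*} {G : SimpleGraph V} {d : ℕ}

open Classical in
-- Deleting a vertex of degree at most `d` lowers the degree sum by at most `2 * d`.
theorem SimpleGraph.IsDegenerate.sum_degree_le (hG : G.IsDegenerate d) (S : Finset V) :
    ∑ v ∈ S, (S.filter (G.Adj v)).card ≤ 2 * d * S.card := by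
  induction S using Finset.strongInduction with
  | H S ih =>
    rcases S.eq_empty_or_nonempty with rfl | hne
    · simp
    obtain ⟨v, hv, hd⟩ := hG S (by simpa using hne)
    rw [Finset.mem_coe] at hv
    have hd' : (S.filter (G.Adj v)).card ≤ d := by
      rw [← Set.ncard_coe_finset]
      refine le_of_eq_of_le ?_ hd
      congr 1
      ext w
      simp [and_comm]
    have hv' : ((S.erase v).filter (G.Adj v)).card = (S.filter (G.Adj v)).card := by
      congr 1
      ext w
      simp only [Finset.mem_filter, Finset.mem_erase]
      exact ⟨fun h => ⟨h.1.2, h.2⟩, fun h => ⟨⟨h.2.ne', h.1⟩, h.2⟩⟩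
    have ih' := ih (S.erase v) (Finset.erase_ssubset hv)
    have hstep : ∀ w ∈ S.erase v, (S.filter (G.Adj w)).card =
        ((S.erase v).filter (G.Adj w)).card + if G.Adj v w then 1 else 0 := fun w _ => by
      conv_lhs => rw [← Finset.insert_erase hv]
      rw [Finset.filter_insert]
      by_cases h : G.Adj w v
      · rw [if_pos h, if_pos h.symm, Finset.card_insert_of_notMem (by simp)]
      · rw [if_neg h, if_neg (fun h' => h h'.symm), add_zero]
    have hsum : ∑ w ∈ S.erase v, (if G.Adj v w then 1 else 0) = (S.filter (G.Adj v)).card := by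
      rw [← hv', Finset.card_filter]
    rw [← Finset.add_sum_erase S _ hv, Finset.sum_congr rfl hstep, Finset.sum_add_distrib, hsum]
    have hc := Finset.card_erase_add_one hv
    rw [← hc]
    nlinarith

/-- The vertices that are still active after `t` rounds of removing all vertices that have at
most `D` active neighbours. -/
def SimpleGraph.peel {V : Type*} (G : SimpleGraph V) (D : ℕ) : ℕ → Set V
  | 0 => Set.univ
  | t + 1 => {v | v ∈ G.peel D t ∧ D < (G.neighborSet v ∩ G.peel D t).ncard}

/-- The neighbours of `v` that were active in the last of the first `t` rounds that `v` began as an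
active vertex. -/
def SimpleGraph.peelOut {V : Type*} (G : SimpleGraph V) (D : ℕ) : ℕ → V → Set V
  | 0, _ => ∅
  | t + 1, v => open Classical in
    if v ∈ G.peel D t then G.neighborSet v ∩ G.peel D t else G.peelOut D t v

/-- Markov's inequality: the average active degree is at most `2 * d`, so at most half of the active
vertices exceed `4 * d`. -/
theorem SimpleGraph.IsDegenerate.two_mul_ncard_peel_succ_le [Fintype V] (hG : G.IsDegenerate d) (t : ℕ) :
    2 * (G.peel (4 * d) (t + 1)).ncard ≤ (G.peel (4 * d) t).ncard := by
  classical
  set S : Finset V := (G.peel (4 * d) t).toFinset with hS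
  set S' : Finset V := (G.peel (4 * d) (t + 1)).toFinset with hS'
  rw [Set.ncard_eq_toFinset_card', Set.ncard_eq_toFinset_card']
  rw [← hS, ← hS']
  have hsub : S' ⊆ S := fun v hv => by
    rw [hS', Set.mem_toFinset] at hv
    rw [hS, Set.mem_toFinset]
    exact hv.1
  have hdeg : ∀ v ∈ S', 4 * d + 1 ≤ (S.filter (G.Adj v)).card := fun v hv => by
    rw [hS', Set.mem_toFinset] at hv
    refine (Nat.succ_le_of_lt hv.2).trans_eq ?_
    rw [← Set.ncard_coe_finset]
    congr 1
    ext w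
    simp [hS, and_comm]
  have h1 : S'.card * (4 * d + 1) ≤ ∑ v ∈ S', (S.filter (G.Adj v)).card := by
    rw [← smul_eq_mul]
    exact Finset.card_nsmul_le_sum _ _ _ hdeg
  have h2 := Finset.sum_le_sum_of_subset (f := fun v => (S.filter (G.Adj v)).card) hsub
  have h3 := hG.sum_degree_le S
  by_contra! h
  have : (4 * d + 1) * S.card < (4 * d + 1) * (2 * S'.card) := by gcongr
  nlinarith

theorem SimpleGraph.IsDegenerate.peel_eq_empty [Fintype V] (hG : G.IsDegenerate d) {t : ℕ}
    (ht : Fintype.card V < 2 ^ t) : G.peel (4 * d) t = ∅ := by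
  have h : ∀ t, 2 ^ t * (G.peel (4 * d) t).ncard ≤ Fintype.card V := fun t => by
    induction t with
    | zero => simp [SimpleGraph.peel, Set.ncard_univ]
    | succ t ih =>
      refine le_trans ?_ ih
      rw [pow_succ, mul_assoc]
      exact Nat.mul_le_mul_left _ (hG.two_mul_ncard_peel_succ_le t)
  rw [← Set.ncard_eq_zero]
  by_contra hne
  have := h t
  have : 2 ^ t * 1 ≤ 2 ^ t * (G.peel (4 * d) t).ncard :=
    Nat.mul_le_mul_left _ (Nat.one_le_iff_ne_zero.mpr hne)
  omega

theorem SimpleGraph.peelOut_subset_neighborSet {D : ℕ} (t : ℕ) (v : V) :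
    G.peelOut D t v ⊆ G.neighborSet v := by
  induction t with
  | zero => simp [peelOut]
  | succ t ih =>
    rw [peelOut]
    split_ifs
    exacts [Set.inter_subset_left, ih]

theorem SimpleGraph.ncard_peelOut_le {D t : ℕ} {v : V} (hv : v ∉ G.peel D t) :
    (G.peelOut D t v).ncard ≤ D := by
  induction t with
  | zero => simp [peelOut]
  | succ t ih =>
    rw [peelOut]
    split_ifs with h
    · by_contra! hlt
      exact hv ⟨h, hlt⟩
    · exact ih h

/-- The endpoint removed first still sees the other as active; in a tie both do. The conjunct `v ∉
G.peel D t` is for the induction: only then is `peelOut` of `v` final. -/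
theorem SimpleGraph.mem_peelOut_or {D : ℕ} (t : ℕ) {u v : V} (huv : G.Adj u v)
    (hu : u ∉ G.peel D t) :
    v ∈ G.peelOut D t u ∨ v ∉ G.peel D t ∧ u ∈ G.peelOut D t v := by
  induction t generalizing u v with
  | zero => exact absurd (Set.mem_univ u) hu
  | succ t ih =>
    by_cases hut : u ∈ G.peel D t
    · by_cases hvt : v ∈ G.peel D t
      · left
        rw [peelOut, if_pos hut]
        exact ⟨huv, hvt⟩
      · right
        refine ⟨fun h => hvt h.1, ?_⟩
        rw [peelOut, if_neg hvt]
        exact (ih huv.symm hvt).resolve_right fun h => h.1 hut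
    · rcases ih huv hut with h | h
      · left
        rwa [peelOut, if_neg hut]
      · right
        refine ⟨fun h' => h.1 h'.1, ?_⟩
        rw [peelOut, if_neg h.1]
        exact h.2

end Degenerate

/-! ### Small families of colourings realising all local patterns -/

section HashFamily

/-- Greedy covering: if every test in `P` is passed by a `1 / M` fraction of `Ω`, then some
`t` elements of `Ω` leave at most a `(1 - 1 / M) ^ t` fraction of the tests unpassed. -/
theorem exists_family_card_unpassed_le {Ω ι : Type*} [Fintype Ω] [Nonempty Ω]
    (passes : ι → Ω → Prop) (P : Finset ι) (M : ℕ)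
    (hM : ∀ p ∈ P, Fintype.card Ω ≤ M * {ω | passes p ω}.ncard) (t : ℕ) :
    ∃ F : Fin t → Ω, ∃ Q ⊆ P, (∀ p ∈ P, p ∉ Q → ∃ i, passes p (F i)) ∧
      Q.card * M ^ t ≤ P.card * (M - 1) ^ t := by
  classical
  induction t with
  | zero => exact ⟨Fin.elim0, P, subset_rfl, fun p h h' => absurd h h', by simp⟩
  | succ t ih =>
    obtain ⟨F, Q, hQP, hF, hQ⟩ := ih
    have hsum : ∑ ω : Ω, Q.card ≤ ∑ ω : Ω, M * (Q.filter (passes · ω)).card := by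
      rw [Finset.sum_const, Finset.card_univ, smul_eq_mul, ← Finset.mul_sum]
      have : ∑ ω : Ω, (Q.filter (passes · ω)).card = ∑ p ∈ Q, {ω | passes p ω}.ncard := by
        refine (Finset.sum_card_bipartiteAbove_eq_sum_card_bipartiteBelow passes).symm.trans ?_
        refine Finset.sum_congr rfl fun p _ => ?_
        rw [Set.ncard_eq_toFinset_card']
        congr 1
        ext ω
        simp [Finset.mem_bipartiteAbove]
      rw [this, Finset.mul_sum, mul_comm, ← smul_eq_mul]
      exact Finset.card_nsmul_le_sum _ _ _ fun p hp => hM p (hQP hp)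
    -- Averaging over `Ω`: some `ω` passes at least a `1 / M` fraction of the remaining tests.
    obtain ⟨ω, -, hω⟩ := Finset.exists_le_of_sum_le Finset.univ_nonempty hsum
    refine ⟨Fin.snoc F ω, Q.filter (¬ passes · ω), (Finset.filter_subset _ _).trans hQP,
      fun p hp hpQ => ?_, ?_⟩
    · by_cases h : p ∈ Q
      · refine ⟨Fin.last t, ?_⟩
        rw [Fin.snoc_last]
        by_contra h'
        exact hpQ (Finset.mem_filter.mpr ⟨h, h'⟩)
      · obtain ⟨i, hi⟩ := hF p hp h
        exact ⟨i.castSucc, by rwa [Fin.snoc_castSucc]⟩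
    · have hcard := Finset.card_filter_add_card_filter_not (s := Q) (passes · ω)
      set x := (Q.filter (¬ passes · ω)).card
      set y := (Q.filter (passes · ω)).card
      have hx : x * M ≤ Q.card * (M - 1) := by
        rcases M with _ | M
        · simp
        · simp only [Nat.add_sub_cancel]
          nlinarith
      calc x * M ^ (t + 1) = x * M * M ^ t := by ring
        _ ≤ Q.card * (M - 1) * M ^ t := Nat.mul_le_mul_right _ hx
        _ = Q.card * M ^ t * (M - 1) := by ring
        _ ≤ P.card * (M - 1) ^ t * (M - 1) := Nat.mul_le_mul_right _ hQ
        _ = P.card * (M - 1) ^ (t + 1) := by ring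

/-- The first two binomial terms of `(m + 1) ^ (m + 1)` already give `2 * m ^ (m + 1)`. Hence `M`
greedy steps halve the unpassed tests. -/
theorem two_mul_sub_one_pow_le {M : ℕ} (hM : 0 < M) : 2 * (M - 1) ^ M ≤ M ^ M := by
  obtain ⟨m, rfl⟩ : ∃ m, M = m + 1 := ⟨M - 1, by omega⟩
  have h : ∀ n : ℕ, m ^ n + n * m ^ (n - 1) ≤ (m + 1) ^ n := fun n => by
    induction n with
    | zero => simp
    | succ n ih =>
      rcases n with _ | n
      · simp
      · simp only [Nat.add_sub_cancel] at ih ⊢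
        calc m ^ (n + 1 + 1) + (n + 1 + 1) * m ^ (n + 1)
            ≤ (m ^ (n + 1) + (n + 1) * m ^ n) * (m + 1) := by
              have : 0 ≤ (n + 1) * m ^ n := Nat.zero_le _
              ring_nf
              ring_nf at this
              omega
          _ ≤ (m + 1) ^ (n + 1) * (m + 1) := Nat.mul_le_mul_right _ ih
          _ = _ := by ring
  have := h (m + 1)
  simp only [Nat.add_sub_cancel] at this ⊢
  have h' : m ^ (m + 1) ≤ (m + 1) * m ^ m := by
    rw [pow_succ, mul_comm]
    exact Nat.mul_le_mul_right _ (Nat.le_succ m)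
  omega

theorem exists_family_all_passed {Ω ι : Type*} [Fintype Ω] [Nonempty Ω]
    (passes : ι → Ω → Prop) (P : Finset ι) (M l t : ℕ) (hM0 : 0 < M)
    (hM : ∀ p ∈ P, Fintype.card Ω ≤ M * {ω | passes p ω}.ncard) (hl : P.card < 2 ^ l)
    (ht : M * l ≤ t) :
    ∃ F : Fin t → Ω, ∀ p ∈ P, ∃ i, passes p (F i) := by
  obtain ⟨F, Q, -, hF, hQ⟩ := exists_family_card_unpassed_le passes P M hM (M * l)
  have h2 : 2 ^ l * (M - 1) ^ (M * l) ≤ M ^ (M * l) := by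
    rw [pow_mul, pow_mul, ← mul_pow]
    exact Nat.pow_le_pow_left (two_mul_sub_one_pow_le hM0) l
  have hQ0 : Q = ∅ := by
    rw [← Finset.card_eq_zero]
    by_contra hne
    have hpos : 0 < M ^ (M * l) := by positivity
    have h3 : 1 * M ^ (M * l) ≤ Q.card * M ^ (M * l) :=
      Nat.mul_le_mul_right _ (Nat.one_le_iff_ne_zero.mpr hne)
    have h4 : (P.card + 1) * (M - 1) ^ (M * l) ≤ 2 ^ l * (M - 1) ^ (M * l) :=
      Nat.mul_le_mul_right _ hl
    have h5 : (M - 1) ^ (M * l) = 0 := by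
      rw [add_mul] at h4
      omega
    rw [h5] at hQ
    omega
  refine ⟨fun i => if h : (i : ℕ) < M * l then F ⟨i, h⟩ else Classical.arbitrary Ω,
    fun p hp => ?_⟩
  obtain ⟨i, hi⟩ := hF p hp (by simp [hQ0])
  exact ⟨⟨i, i.2.trans_le ht⟩, by simpa using hi⟩

/-- A uniformly random colouring agrees with `χ₀` on `S` with probability `|β| ^ (-|S|)`. -/
theorem card_fun_le_mul_ncard_eqOn {α β : Type*} [Fintype α] [DecidableEq α]
    [Fintype β] [Nonempty β] (χ₀ : α → β)
    (S : Finset α) {m : ℕ} (hS : S.card ≤ m) :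
    Fintype.card (α → β) ≤ Fintype.card β ^ m * {χ : α → β | ∀ x ∈ S, χ x = χ₀ x}.ncard := by
  have h : {χ : α → β | ∀ x ∈ S, χ x = χ₀ x} =
      (Fintype.piFinset fun x => if x ∈ S then {χ₀ x} else Finset.univ : Finset (α → β)) := by
    ext χ
    simp only [Set.mem_ofPred_eq, Finset.mem_coe, Fintype.mem_piFinset]
    refine forall_congr' fun x => ?_
    split_ifs with hx <;> simp [hx]
  rw [h, Set.ncard_coe_finset, Fintype.card_piFinset, Fintype.card_fun]
  have h2 : ∏ x : α, (if x ∈ S then {χ₀ x} else Finset.univ : Finset β).card =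
      Fintype.card β ^ (Fintype.card α - S.card) := by
    rw [← Finset.card_compl, ← Finset.prod_const, ← Finset.prod_compl_mul_prod S]
    rw [Finset.prod_eq_one (s := S) (by intro x hx; simp [hx]), mul_one]
    refine Finset.prod_congr rfl fun x hx => ?_
    rw [if_neg (Finset.mem_compl.mp hx), Finset.card_univ]
  rw [h2, ← pow_add]
  exact Nat.pow_le_pow_right Fintype.card_pos (by omega)

/-- A number of colourings that suffices, per unit of the logarithm of the size of the domain, to
realise all partial colourings of `m` points with `k` colours. -/
def hashFamilySize (k m : ℕ) : ℕ := (k + 1) ^ m * (m * (k + 1) + 1)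

/-- A test is a consistent list of `m` point-colour pairs. There are at most `2 ^ (m * (L + k))` of
them, each passed by a `(k + 1) ^ (-m)` fraction of colourings. -/
theorem exists_hashFamily_fin (k m L : ℕ) :
    ∃ F : Fin (hashFamilySize k m * (L + 1)) → Fin (2 ^ L) → Option (Fin k),
      ∀ (χ : Fin (2 ^ L) → Option (Fin k)) (S : Finset (Fin (2 ^ L))), S.card ≤ m →
        S.Nonempty → ∃ i, ∀ x ∈ S, F i x = χ x := by
  let passes : (Fin m → Fin (2 ^ L) × Option (Fin k)) → (Fin (2 ^ L) → Option (Fin k)) → Prop :=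
    fun p χ => ∀ r, χ (p r).1 = (p r).2
  classical
  have hM : ∀ p ∈ Finset.univ.filter fun p => ∃ χ, passes p χ,
      Fintype.card (Fin (2 ^ L) → Option (Fin k)) ≤
        (k + 1) ^ m * {χ | passes p χ}.ncard := by
    intro p hp
    obtain ⟨χ, hχ⟩ := (Finset.mem_filter.mp hp).2
    have := card_fun_le_mul_ncard_eqOn χ (Finset.univ.image fun r => (p r).1) (m := m)
      (Finset.card_image_le.trans (by simp))
    rw [Fintype.card_option, Fintype.card_fin] at this
    refine this.trans (Nat.mul_le_mul_left _ (Set.ncard_le_ncard fun χ' h r => ?_))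
    rw [h _ (Finset.mem_image_of_mem _ (Finset.mem_univ r))]
    exact hχ r
  have hl : (Finset.univ.filter fun p => ∃ χ, passes p χ).card < 2 ^ (m * (L + k) + 1) := by
    refine (Finset.card_filter_le _ _).trans_lt ?_
    rw [Finset.card_univ, Fintype.card_fun, Fintype.card_prod, Fintype.card_option,
      Fintype.card_fin, Fintype.card_fin, Fintype.card_fin, pow_succ]
    have : (2 ^ L * (k + 1)) ^ m ≤ 2 ^ (m * (L + k)) := by
      rw [mul_comm m, pow_mul, pow_add]
      exact Nat.pow_le_pow_left (Nat.mul_le_mul_left _ Nat.lt_two_pow_self) m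
    have : 0 < 2 ^ (m * (L + k)) := by positivity
    omega
  have ht : (k + 1) ^ m * (m * (L + k) + 1) ≤ hashFamilySize k m * (L + 1) := by
    rw [hashFamilySize, mul_assoc]
    refine Nat.mul_le_mul_left _ ?_
    nlinarith [Nat.zero_le (m * k * L)]
  obtain ⟨F, hF⟩ := exists_family_all_passed passes _ _ _ _ (by positivity) hM hl ht
  refine ⟨F, fun χ S hS hne => ?_⟩
  -- A set with fewer than `m` points is listed with repetitions of `x₀`, hence nonemptiness.
  obtain ⟨f, hf⟩ : ∃ f : Fin m → Fin (2 ^ L), ∀ x ∈ S, ∃ r, f r = x := by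
    obtain ⟨x₀, -⟩ := hne
    refine ⟨fun r => if h : (r : ℕ) < S.card then (S.equivFin.symm ⟨r, h⟩ : Fin (2 ^ L)) else x₀,
      fun x hx => ⟨⟨S.equivFin ⟨x, hx⟩, (S.equivFin ⟨x, hx⟩).2.trans_le hS⟩, ?_⟩⟩
    simp
  obtain ⟨i, hi⟩ := hF (fun r => (f r, χ (f r))) (by simpa using ⟨χ, fun _ => rfl⟩)
  refine ⟨i, fun x hx => ?_⟩
  obtain ⟨r, rfl⟩ := hf x hx
  exact hi r

/-- A family of colourings of the natural numbers below `2 ^ L`, in the form of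
`hashFamilySize k m` chunks of `L + 1` colourings, that realises all partial colourings of at most
`m` points. -/
theorem exists_hashFamily (k m L : ℕ) :
    ∃ F : ℕ → ℕ → ℕ → Option (Fin k),
      ∀ (χ : ℕ → Option (Fin k)) (S : Set ℕ), (∀ x ∈ S, x < 2 ^ L) → S.ncard ≤ m → S.Nonempty →
        ∃ a < hashFamilySize k m, ∃ i ≤ L, ∀ x ∈ S, F a i x = χ x := by
  classical
  obtain ⟨F, hF⟩ := exists_hashFamily_fin k m L
  refine ⟨fun a i x => if h : a < hashFamilySize k m ∧ i < L + 1 ∧ x < 2 ^ L then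
    F (finProdFinEquiv (⟨a, h.1⟩, ⟨i, h.2.1⟩)) ⟨x, h.2.2⟩ else none, fun χ S hS hm hne => ?_⟩
  have hcard : (Finset.univ.filter fun x : Fin (2 ^ L) => (x : ℕ) ∈ S).card ≤ m := by
    rw [← Set.ncard_coe_finset]
    refine le_trans ?_ hm
    refine Set.ncard_le_ncard_of_injOn (fun x => (x : ℕ)) (fun x hx => by simpa using hx)
      (fun x _ y _ h => Fin.ext h)
      ((Set.finite_lt_nat (2 ^ L)).subset hS)
  have hne' : (Finset.univ.filter fun x : Fin (2 ^ L) => (x : ℕ) ∈ S).Nonempty := by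
    obtain ⟨x, hx⟩ := hne
    exact ⟨⟨x, hS x hx⟩, by simpa using hx⟩
  obtain ⟨e, he⟩ := hF (fun x => χ x) _ hcard hne'
  obtain ⟨⟨a, i⟩, rfl⟩ := finProdFinEquiv.surjective e
  refine ⟨a, a.2, i, Nat.le_of_lt_succ i.2, fun x hx => ?_⟩
  simp only [a.2, i.2, hS x hx, and_self, dif_pos, Fin.eta]
  exact he ⟨x, hS x hx⟩ (by simpa using hx)

end HashFamily

/-! ### Arc consistency and induced copies -/

section Survives

variable {V : Type*} {k : ℕ}

/-- Arc consistency for `s` rounds: `v` has a colour that is compatible with the colours in `out v`,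
and for each neighbour of its colour in `T` it has a neighbour of that colour that survives `s - 1`
rounds. -/
def SimpleGraph.Survives (G : SimpleGraph V) (T : SimpleGraph (Fin k)) (out : V → Set V)
    (χ : V → Option (Fin k)) : ℕ → V → Prop
  | 0, _ => True
  | s + 1, v => ∃ i, χ v = some i ∧ (∀ w ∈ out v, ∀ j, χ w = some j → T.Adj i j) ∧
      ∀ j, T.Adj i j → ∃ w, G.Adj v w ∧ χ w = some j ∧ G.Survives T out χ s w

variable {G : SimpleGraph V} {T : SimpleGraph (Fin k)} {out : V → Set V} {χ : V → Option (Fin k)}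

theorem SimpleGraph.IsTree.nonempty_embedding_of_survives (hT : T.IsTree)
    (hout : ∀ u v, G.Adj u v → v ∈ out u ∨ u ∈ out v) {v : V} (hv : G.Survives T out χ k v) :
    Nonempty (T ↪g G) := by
  obtain ⟨k', rfl⟩ : ∃ k', k = k' + 1 := by
    obtain ⟨i⟩ := hT.connected.nonempty
    exact ⟨k - 1, by have := i.2; omega⟩
  have hr : ∃ r, χ v = some r := by
    obtain ⟨r, hr, -⟩ := hv
    exact ⟨r, hr⟩
  obtain ⟨r, hr⟩ := hr
  obtain ⟨φ, hφ, hs⟩ := hT.exists_hom_of_extendable (G := G) (n := k' + 1)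
    (P := fun s i v => χ v = some i ∧ G.Survives T out χ s v) (r := r) (v₀ := v) (by simp)
    ⟨hr, hv⟩ (fun s i v hsv j hij => by
      obtain ⟨hi, i', hi', -, h⟩ := hsv
      rw [hi, Option.some_inj] at hi'
      subst hi'
      exact h j hij)
  have hχ : ∀ i, χ (φ i) = some i := fun i => (hs i).choose_spec.1
  have hadj : ∀ i j, φ j ∈ out (φ i) → T.Adj i j := fun i j hij => by
    obtain ⟨s, -, i', hi', h, -⟩ := hs i
    rw [hχ, Option.some_inj] at hi'
    subst hi'
    exact h _ hij j (hχ j)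
  refine ⟨⟨⟨φ, fun i j hij => ?_⟩, fun {i j} => ⟨fun h => ?_, hφ i j⟩⟩⟩
  · rw [← Option.some_inj, ← hχ i, ← hχ j, hij]
  · exact (hout _ _ h).elim (hadj i j) fun h => (hadj j i h).symm

theorem SimpleGraph.survives_of_embedding (φ : T ↪g G) (hout : ∀ v, out v ⊆ G.neighborSet v)
    (hχ : ∀ i, χ (φ i) = some i)
    (hχ' : ∀ i, ∀ w ∈ out (φ i), w ∉ Set.range φ → χ w = none) (s : ℕ) (i : Fin k) :
    G.Survives T out χ s (φ i) := by
  induction s generalizing i with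
  | zero => trivial
  | succ s ih =>
    refine ⟨i, hχ i, fun w hw j hj => ?_, fun j hij => ⟨φ j, φ.map_adj_iff.mpr hij, hχ j, ih j⟩⟩
    by_cases h : w ∈ Set.range φ
    · obtain ⟨j', rfl⟩ := h
      rw [hχ, Option.some_inj] at hj
      subst hj
      exact φ.map_adj_iff.mp (hout _ hw)
    · rw [hχ' i w hw h] at hj
      cases hj

end Survives

/-! ### The algorithm -/

namespace Congest

/-- The `L` low-order bits of `x`. -/
def idBits (L x : ℕ) : List Bool :=
  List.ofFn fun i : Fin L => x.testBit i

noncomputable def idOfBits (L : ℕ) : List Bool → ℕ :=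
  Function.invFunOn (idBits L) {x | x < 2 ^ L}

theorem idOfBits_idBits {L x : ℕ} (hx : x < 2 ^ L) : idOfBits L (idBits L x) = x := by
  refine Set.InjOn.leftInvOn_invFunOn (s := {x | x < 2 ^ L}) (fun x hx y hy h => ?_) hx
  refine Nat.eq_of_testBit_eq fun i => ?_
  by_cases hi : i < L
  · exact congrFun (List.ofFn_injective h) ⟨i, hi⟩
  · have hp : 2 ^ L ≤ 2 ^ i := Nat.pow_le_pow_right (by norm_num) (by omega)
    rw [Nat.testBit_lt_two_pow (lt_of_lt_of_le hx hp),
      Nat.testBit_lt_two_pow (lt_of_lt_of_le hy hp)]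

/-- Colours are functions of identifiers, so a node computes its neighbours' colours without
communication. -/
structure TreeDetectionState where
  N : ℕ
  id : ℕ
  time : ℕ
  /-- The identifier of the neighbour behind each port. -/
  nbrId : ℕ → ℕ
  /-- Whether the node has not been peeled off yet. -/
  active : Prop
  /-- The identifiers of the out-neighbours. -/
  outId : Set ℕ
  /-- Whether the node has survived arc consistency so far, for each chunk of colourings and each
  colouring in the chunk. -/
  alive : ℕ → ℕ → Prop

open Classical in
/-- Detection of induced copies of `T`: exchange identifiers, orient the edges by peeling off
vertices of degree at most `D`, and test arc consistency for all colourings `F L a i` with `a < g`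
and `i ≤ L`, where `L` is the bit length of the identifiers, for `k` rounds for each `a`. -/
noncomputable def treeDetection {k : ℕ} (T : SimpleGraph (Fin k)) (D g : ℕ)
    (F : ℕ → ℕ → ℕ → ℕ → Option (Fin k)) : Algorithm where
  State := TreeDetectionState
  init N x _ := ⟨N, x, 0, fun _ => 0, True, ∅, fun _ _ => True⟩
  send _ s _ :=
    if s.time = 0 then idBits (Nat.clog 2 s.N) s.id
    else if s.time < Nat.clog 2 s.N + 2 then [decide s.active]
    else List.ofFn fun i : Fin (Nat.clog 2 s.N + 1) =>
      -- The quotient by `k` is the index of the chunk being tested.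
      decide (s.alive ((s.time - (Nat.clog 2 s.N + 2)) / k) i)
  recv δ s m :=
    if s.time = 0 then
      { s with
        time := 1
        nbrId := fun q => if h : q < δ then idOfBits (Nat.clog 2 s.N) (m ⟨q, h⟩) else 0 }
    else if s.time < Nat.clog 2 s.N + 2 then
      { s with
        time := s.time + 1
        active := s.active ∧ D < {p | m p = [true]}.ncard
        outId := if s.active then (fun p : Fin δ => s.nbrId p) '' {p | m p = [true]} else s.outId }
    else if s.time < Nat.clog 2 s.N + 2 + g * k then
      { s with
        time := s.time + 1
        alive := fun a i =>
          if a * k ≤ s.time - (Nat.clog 2 s.N + 2) ∧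
              s.time - (Nat.clog 2 s.N + 2) < a * k + k then
            ∃ c, F (Nat.clog 2 s.N) a i s.id = some c ∧
              (∀ x ∈ s.outId, ∀ j, F (Nat.clog 2 s.N) a i x = some j → T.Adj c j) ∧
              ∀ j, T.Adj c j → ∃ p : Fin δ, F (Nat.clog 2 s.N) a i (s.nbrId p) = some j ∧
                (m p)[i]? = some true
          else s.alive a i }
    else s
  out s :=
    if Nat.clog 2 s.N + 2 + g * k ≤ s.time then
      some (decide (∃ a < g, ∃ i ≤ Nat.clog 2 s.N, s.alive a i))
    else none
  out_recv δ s m y h := by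
    split_ifs at h with h₁
    have h₂ : ¬ s.time = 0 := by omega
    have h₃ : ¬ s.time < Nat.clog 2 s.N + 2 := by omega
    have h₄ : ¬ s.time < Nat.clog 2 s.N + 2 + g * k := by omega
    simp only [h₂, h₃, h₄, if_false, h₁, if_true]
    exact h

/-! ### Invariants of the execution -/

section Run

variable {V : Type*} {G : SimpleGraph V} {N : ℕ} (net : Network G N)

theorem Network.nbr_injective (v : V) : Function.Injective (net.nbr v) :=
  Subtype.val_injective.comp (net.port v).injective

theorem Network.adj_nbr (v : V) (p : Fin (net.deg v)) : G.Adj v (net.nbr v p) :=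
  (net.port v p).2

theorem Network.exists_nbr_eq {v w : V} (h : G.Adj v w) : ∃ p, net.nbr v p = w :=
  ⟨(net.port v).symm ⟨w, h⟩, by simp [Network.nbr]⟩

theorem Network.image_nbr (v : V) (S : Set V) :
    net.nbr v '' {p | net.nbr v p ∈ S} = G.neighborSet v ∩ S := by
  ext w
  constructor
  · rintro ⟨p, hp, rfl⟩
    exact ⟨net.adj_nbr v p, hp⟩
  · rintro ⟨h, hS⟩
    obtain ⟨p, rfl⟩ := net.exists_nbr_eq h
    exact ⟨p, hS, rfl⟩

theorem Network.ident_lt (v : V) : (net.ident v : ℕ) < 2 ^ Nat.clog 2 N :=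
  (net.ident v).2.trans_le (Nat.le_pow_clog (by norm_num) N)

/-- The identifier of the neighbour of `v` behind each port. -/
def Network.nbrIdent (v : V) (q : ℕ) : ℕ :=
  if h : q < net.deg v then net.ident (net.nbr v ⟨q, h⟩) else 0

variable {k : ℕ} (T : SimpleGraph (Fin k)) (D g : ℕ) (F : ℕ → ℕ → ℕ → ℕ → Option (Fin k))

theorem state_treeDetection_peel (s : ℕ) (hs : s ≤ Nat.clog 2 N + 1) (v : V) :
    net.state (treeDetection T D g F) (1 + s) v =
      (⟨N, net.ident v, 1 + s, net.nbrIdent v, v ∈ G.peel D s,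
        (fun w => (net.ident w : ℕ)) '' G.peelOut D s v, fun _ _ => True⟩ : TreeDetectionState) := by
  classical
  induction s generalizing v with
  | zero =>
    simp [Network.state, treeDetection, SimpleGraph.peel, SimpleGraph.peelOut]
    funext q
    unfold Network.nbrIdent
    split_ifs with h
    · exact idOfBits_idBits (net.ident_lt _)
    · rfl
  | succ s ih =>
    have hstep : ∀ S : TreeDetectionState, S = net.state (treeDetection T D g F) (1 + s) v →
        net.state (treeDetection T D g F) (1 + (s + 1)) v =
        (treeDetection T D g F).recv (net.deg v) S
          fun p => [decide (net.nbr v p ∈ G.peel D s)] := by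
      rintro _ rfl
      rw [← add_assoc, Network.state]
      congr 1
      funext p
      rw [ih (by omega) (net.nbr v p)]
      simp only [treeDetection]
      rw [if_neg (by omega), if_pos (by omega)]
    rw [hstep _ (ih (by omega) v).symm]
    simp only [treeDetection]
    rw [if_neg (by omega), if_pos (by omega)]
    have hset : {p | [decide (net.nbr v p ∈ G.peel D s)] = [true]} =
        {p | net.nbr v p ∈ G.peel D s} := by
      ext p
      simp
    rw [hset]
    congr 1
    · rw [← Set.ncard_image_of_injective _ (net.nbr_injective v), net.image_nbr]
      rfl
    · rw [SimpleGraph.peelOut]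
      split_ifs
      · rw [← net.image_nbr, Set.image_image]
        refine Set.image_congr fun p _ => ?_
        simp [Network.nbrIdent]
      · rfl

/-- With truncated subtraction, `min k (τ - a * k)` counts the rounds chunk `a` has run: `0` before
its window, `k` after it. -/
theorem state_treeDetection_survives (hk : 0 < k) (τ : ℕ) (hτ : τ ≤ g * k) (v : V) :
    ∃ act alive, net.state (treeDetection T D g F) (Nat.clog 2 N + 2 + τ) v =
      (⟨N, net.ident v, Nat.clog 2 N + 2 + τ, net.nbrIdent v, act,
        (fun w => (net.ident w : ℕ)) '' G.peelOut D (Nat.clog 2 N + 1) v, alive⟩ :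
        TreeDetectionState) ∧
      ∀ a, ∀ i ≤ Nat.clog 2 N, alive a i ↔
        G.Survives T (G.peelOut D (Nat.clog 2 N + 1)) (fun w => F (Nat.clog 2 N) a i (net.ident w))
          (min k (τ - a * k)) v := by
  classical
  set L := Nat.clog 2 N with hL
  induction τ generalizing v with
  | zero =>
    have h := state_treeDetection_peel net T D g F (L + 1) le_rfl v
    rw [show 1 + (L + 1) = L + 2 + 0 by omega] at h
    exact ⟨_, _, h, fun a i _ => by simp [SimpleGraph.Survives]⟩
  | succ τ ih =>
    choose act alive hst hal using fun v => ih (by omega) v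
    have hstep : ∀ S : TreeDetectionState,
        S = net.state (treeDetection T D g F) (L + 2 + τ) v →
        net.state (treeDetection T D g F) (L + 2 + (τ + 1)) v =
        (treeDetection T D g F).recv (net.deg v) S
          fun p => List.ofFn fun i : Fin (L + 1) => decide (alive (net.nbr v p) (τ / k) i) := by
      rintro _ rfl
      rw [← add_assoc, Network.state]
      congr 1
      funext p
      rw [hst (net.nbr v p)]
      simp only [treeDetection, ← hL]
      rw [if_neg (by omega), if_neg (by omega), show L + 2 + τ - (L + 2) = τ by omega]
      rfl
    rw [hstep _ (hst v).symm]
    simp only [treeDetection, ← hL]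
    rw [if_neg (by omega), if_neg (by omega), if_pos (by omega),
      show L + 2 + τ - (L + 2) = τ by omega]
    refine ⟨_, _, rfl, fun a i hi => ?_⟩
    split_ifs with h
    · have hdiv : τ / k = a := by
        rw [Nat.div_eq_iff hk]
        omega
      rw [show min k (τ + 1 - a * k) = min k (τ - a * k) + 1 by omega, hdiv,
        SimpleGraph.Survives]
      refine exists_congr fun c => and_congr_right fun _ => and_congr (by simp) ?_
      refine forall_congr' fun j => imp_congr_right fun _ => ?_
      constructor
      · rintro ⟨p, hp, hp'⟩
        refine ⟨net.nbr v p, net.adj_nbr v p, by simpa [Network.nbrIdent] using hp, ?_⟩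
        rw [← hal _ _ _ hi]
        simpa [-List.ofFn_succ, Nat.lt_succ_of_le hi] using hp'
      · rintro ⟨w, hw, hw', hs⟩
        obtain ⟨p, rfl⟩ := net.exists_nbr_eq hw
        rw [← hal _ _ _ hi] at hs
        refine ⟨p, by simpa [Network.nbrIdent] using hw', ?_⟩
        simpa [-List.ofFn_succ, Nat.lt_succ_of_le hi] using hs
    · rw [hal v a i hi, show min k (τ + 1 - a * k) = min k (τ - a * k) by omega]

theorem length_message_treeDetection_le (t : ℕ) (ht : t < Nat.clog 2 N + 2 + g * k) (hk : 0 < k)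
    (v : V) (p : Fin (net.deg v)) :
    (net.message (treeDetection T D g F) t v p).length ≤ Nat.clog 2 N + 1 := by
  have hN : (net.state (treeDetection T D g F) t v : TreeDetectionState).N = N := by
    rcases t with _ | t
    · rfl
    by_cases h : t ≤ Nat.clog 2 N + 1
    · rw [add_comm t, state_treeDetection_peel net T D g F t h v]
    · obtain ⟨act, alive, hst, -⟩ :=
        state_treeDetection_survives net T D g F hk (t + 1 - (Nat.clog 2 N + 2)) (by omega) v
      rw [show Nat.clog 2 N + 2 + (t + 1 - (Nat.clog 2 N + 2)) = t + 1 by omega] at hst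
      rw [hst]
  rw [Network.message]
  generalize net.state (treeDetection T D g F) t v = s at hN ⊢
  obtain rfl : s.N = N := hN
  simp only [treeDetection]
  split_ifs <;> simp [idBits]

theorem out_treeDetection (hk : 0 < k) (v : V) :
    ∃ y, (treeDetection T D g F).out
        (net.state (treeDetection T D g F) (Nat.clog 2 N + 2 + g * k) v) = some y ∧
      (y = true ↔ ∃ a < g, ∃ i ≤ Nat.clog 2 N,
        G.Survives T (G.peelOut D (Nat.clog 2 N + 1))
          (fun w => F (Nat.clog 2 N) a i (net.ident w)) k v) := by
  classical
  obtain ⟨act, alive, hst, hal⟩ := state_treeDetection_survives net T D g F hk (g * k) le_rfl v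
  rw [hst]
  refine ⟨decide (∃ a < g, ∃ i ≤ Nat.clog 2 N, alive a i), ?_, ?_⟩
  · simp [treeDetection]
  · rw [decide_eq_true_iff]
    refine exists_congr fun a => and_congr_right fun ha => exists_congr fun i =>
      and_congr_right fun hi => ?_
    rw [hal a i hi]
    have : a * k + k ≤ g * k := by
      rw [← Nat.succ_mul]
      exact Nat.mul_le_mul_right k ha
    rw [show min k (g * k - a * k) = k by omega]

end Run

/-! ### Correctness and complexity -/

section Correctness

variable {V : Type*} [Fintype V] {G : SimpleGraph V} {N d k : ℕ} {T : SimpleGraph (Fin k)}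

theorem exists_survives_of_embedding (net : Network G N) {D : ℕ} {out : V → Set V}
    {F : ℕ → ℕ → ℕ → Option (Fin k)} {g : ℕ}
    (hF : ∀ (χ : ℕ → Option (Fin k)) (S : Set ℕ), (∀ x ∈ S, x < 2 ^ Nat.clog 2 N) →
      S.ncard ≤ k * (D + 1) → S.Nonempty →
        ∃ a < g, ∃ i ≤ Nat.clog 2 N, ∀ x ∈ S, F a i x = χ x)
    (hout : ∀ v, out v ⊆ G.neighborSet v) (hD : ∀ v, (out v).ncard ≤ D) (φ : T ↪g G) (r : Fin k) :
    ∃ a < g, ∃ i ≤ Nat.clog 2 N,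
      G.Survives T out (fun w => F a i (net.ident w)) k (φ r) := by
  classical
  let ι : V → ℕ := fun v => net.ident v
  have hι : Function.Injective ι := fun u v h => net.ident.injective (Fin.ext h)
  -- Only these vertices need prescribed colours: the copy and its out-neighbours.
  let S : Set V := ⋃ i, insert (φ i) (out (φ i))
  have hS : S.ncard ≤ k * (D + 1) := by
    have h := Set.ncard_iUnion_le_of_fintype fun i => insert (φ i) (out (φ i))
    refine h.trans ?_
    calc ∑ i, (insert (φ i) (out (φ i))).ncard ≤ ∑ _i : Fin k, (D + 1) :=
          Finset.sum_le_sum fun i _ => (Set.ncard_insert_le _ _).trans (by have := hD (φ i); omega)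
      _ = k * (D + 1) := by simp
  have hχ : ∃ χ : ℕ → Option (Fin k), (∀ i, χ (ι (φ i)) = some i) ∧
      ∀ v, v ∉ Set.range φ → χ (ι v) = none :=
    ⟨fun x => if h : ∃ i, ι (φ i) = x then some h.choose else none, fun i => by
      have h : ∃ j, ι (φ j) = ι (φ i) := ⟨i, rfl⟩
      beta_reduce
      rw [dif_pos h, Option.some_inj]
      exact φ.injective (hι h.choose_spec), fun v hv => dif_neg fun ⟨i, hi⟩ => hv ⟨i, hι hi⟩⟩
  obtain ⟨χ, hχ₁, hχ₂⟩ := hχ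
  obtain ⟨a, ha, i, hi, h⟩ := hF χ (ι '' S) (by rintro _ ⟨v, -, rfl⟩; exact net.ident_lt v)
    ((Set.ncard_image_le S.toFinite).trans hS)
    ⟨ι (φ r), φ r, Set.mem_iUnion.mpr ⟨r, Set.mem_insert _ _⟩, rfl⟩
  refine ⟨a, ha, i, hi, SimpleGraph.survives_of_embedding φ hout (fun j => ?_)
    (fun j w hw hw' => ?_) k r⟩
  · exact (h _ ⟨φ j, Set.mem_iUnion.mpr ⟨j, Set.mem_insert _ _⟩, rfl⟩).trans (hχ₁ j)
  · exact (h _ ⟨w, Set.mem_iUnion.mpr ⟨j, Set.mem_insert_of_mem _ hw⟩, rfl⟩).trans (hχ₂ w hw')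

/-- The bound `hB` is needed only if there is an edge: on a single vertex the bandwidth may be `0`,
but nothing is sent. -/
theorem detectsInduced_treeDetection (hG : G.IsDegenerate d) (hT : T.IsTree) (net : Network G N)
    {F : ℕ → ℕ → ℕ → ℕ → Option (Fin k)} {g : ℕ}
    (hF : ∀ L (χ : ℕ → Option (Fin k)) (S : Set ℕ), (∀ x ∈ S, x < 2 ^ L) →
      S.ncard ≤ k * (4 * d + 1) → S.Nonempty →
        ∃ a < g, ∃ i ≤ L, ∀ x ∈ S, F L a i x = χ x) {B : ℕ}
    (hB : ∀ u v, G.Adj u v → Nat.clog 2 N + 1 ≤ B) :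
    DetectsInduced (treeDetection T (4 * d) g F) net T B (Nat.clog 2 N + 2 + g * k) := by
  have hk : 0 < k := by
    obtain ⟨i⟩ := hT.connected.nonempty
    exact i.pos
  -- `L + 1` rounds suffice since `|V| ≤ N ≤ 2 ^ L < 2 ^ (L + 1)`.
  have hpeel : G.peel (4 * d) (Nat.clog 2 N + 1) = ∅ := by
    refine hG.peel_eq_empty ?_
    have h := Fintype.card_le_of_embedding net.ident
    rw [Fintype.card_fin] at h
    have h' := Nat.le_pow_clog (b := 2) (by norm_num) N
    have : 0 < 2 ^ Nat.clog 2 N := by positivity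
    rw [pow_succ]
    omega
  have hinactive : ∀ v, v ∉ G.peel (4 * d) (Nat.clog 2 N + 1) := by simp [hpeel]
  choose y hy hy' using out_treeDetection net T (4 * d) g F hk
  refine ⟨fun t ht v p => ?_, y, hy, ?_, ?_⟩
  · exact (length_message_treeDetection_le net T (4 * d) g F t ht hk v p).trans
      (hB _ _ (net.adj_nbr v p))
  · rintro _ ⟨φ, r, rfl⟩
    rw [hy']
    exact exists_survives_of_embedding net (hF _) (SimpleGraph.peelOut_subset_neighborSet _)
      (fun v => SimpleGraph.ncard_peelOut_le (hinactive v)) φ r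
  · rintro ⟨v, hv⟩
    obtain ⟨a, -, i, -, h⟩ := (hy' v).mp hv
    exact hT.nonempty_embedding_of_survives
      (fun u v huv => (SimpleGraph.mem_peelOut_or _ huv (hinactive u)).imp_right And.right) h

end Correctness

end Congest

theorem mainTheorem7 :
    ∃ f : ℕ → ℕ → ℕ, ∀ c : ℕ, ∃ b C : ℕ,
      ∀ (d k : ℕ) (T : SimpleGraph (Fin k)), T.IsTree →
        ∃ A : Congest.Algorithm,
          ∀ (V : Type*) [Fintype V] (G : SimpleGraph V), G.IsDegenerate d →
            ∀ (N : ℕ), N ≤ Fintype.card V ^ c → ∀ net : Congest.Network G N,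
              ∃ R : ℕ, R ≤ f d k + C * Nat.clog 2 (Fintype.card V) ∧
                Congest.DetectsInduced A net T (b * Nat.clog 2 (Fintype.card V)) R := by
  -- The run takes `L + 2 + g * k` rounds with `L ≤ c * Nat.clog 2 |V|`; the extra unit in `b` pays
  -- for the message length `L + 1`.
  refine ⟨fun d k => 2 + hashFamilySize k (k * (4 * d + 1)) * k, fun c => ⟨c + 1, c,
    fun d k T hT => ?_⟩⟩
  choose F hF using exists_hashFamily k (k * (4 * d + 1))
  refine ⟨Congest.treeDetection T (4 * d) (hashFamilySize k (k * (4 * d + 1))) F,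
    fun V _ G hG N hN net => ⟨_, ?_, Congest.detectsInduced_treeDetection hG hT net hF ?_⟩⟩
  all_goals
    have hlog : Nat.clog 2 N ≤ c * Nat.clog 2 (Fintype.card V) := by
      refine Nat.clog_le_of_le_pow (hN.trans ?_)
      rw [mul_comm, pow_mul]
      exact Nat.pow_le_pow_left (Nat.le_pow_clog (by norm_num) _) c
  · beta_reduce
    omega
  · intro u v huv
    have : Nontrivial V := ⟨u, v, huv.ne⟩
    have := Nat.clog_pos (b := 2) (by norm_num) (Fintype.one_lt_card (α := V))
    rw [add_mul]
    omega
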